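/- Work in homogeneous coordinates. Let $$\mathbb H=\{k\in\mathbb Z^4:\ k_1+k_2+k_3+k_4=0,\ k_1\equiv k_2\equiv k_3\equiv k_4 \!\!\!\pmod 4\},$$ $$\triangle_H=\{t\in\mathbb R^4:\ t_1+t_2+t_3+t_4=0,\ 0\le t_1-t_2,\ t_2-t_3,\ t_3-t_4,\ t_1-t_4\le 1\}$$ (all four differences lie in $[0,1]$), and let $C(\triangle_H)$ be the space of continuous complex-valued functions on $\triangle_H$ with the uniform norm. For $k\in\mathbb H$ put $\phi_k(t)=e^{\frac{\pi i}{2}k\cdot t}$ and, with $t\sigma=(t_{\sigma(1)},\dots,t_{\sigma(4)})$, $$\mathsf{TC}_k(t)=\frac1{24}\sum_{\sigma\in S_4}\phi_k(t\sigma),\qquad \mathsf{TS}_k(t)=-\frac1{24}\sum_{\sigma\in S_4}\operatorname{sgn}(\sigma)\,\phi_k(t\sigma).$$ For an integer $n\ge 1$ let $$\Lambda_n=\{k\in\mathbb H: k_4\le k_3\le k_2\le k_1\le k_4+4n\},\qquad \Lambda_n^\circ=\{k\in\mathbb H: k_4<k_3<k_2<k_1<k_4+4n\},$$ and for $j\in\Lambda_n$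 let - $\lambda_j^{(n)}=24$ if $j\in\Lambda_n^\circ$; - $\lambda_j^{(n)}=12$ if exactly one of the four inequalities defining $\Lambda_n$ is an equality at $j$; - $\lambda_j^{(n)}=6$ if $j=(2m,2m,-2m,-2m)$ or $j=(2m+n,n-2m,n-2m,2m-3n)$ for some integer $0<m<n$; - $\lambda_j^{(n)}=4$ if $j$ is one of $(m,m,m,-3m)$, $(3m,-m,-m,-m)$, $(n+m,n+m,n-3m,m-3n)$, $(3n-m,3m-n,-n-m,-n-m)$ for some integer $0<m<n$; - $\lambda_j^{(n)}=1$ if $j$ is one of $(0,0,0,0)$, $(2n,2n,-2n,-2n)$, $(3n,-n,-n,-n)$, $(n,n,n,-3n)$. Define the operators $\mathcal L_n$ (associated with the interior points $\Lambda_n^\circ$) and $\mathcal L_n^*$ (associated with all points $\Lambda_n$) of trigonometric interpolation on $C(\triangle_H)$ by $$\mathcal L_nf(t)=\sum_{j\in\Lambda_n^\circ}f\!\left(\tfrac{j}{4n}\right)\ell^\circ_{j,n}(t),\qquad \ell^\circ_{j,n}(t)=\frac{144}{n^3}\sum_{k\in\Lambda_n^\circ}\mathsf{TS}_k(t)\,\overline{\mathsf{TS}_k\!\left(\tfrac{j}{4n}\right)},$$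 $$\mathcal L_n^*f(t)=\sum_{j\in\Lambda_n}f\!\left(\tfrac{j}{4n}\right)\ell^\triangle_{j,n}(t),\qquad \ell^\triangle_{j,n}(t)=\frac{\lambda_j^{(n)}}{4n^3}\sum_{k\in\Lambda_n}\lambda_k^{(n)}\,\mathsf{TC}_k(t)\,\overline{\mathsf{TC}_k\!\left(\tfrac{j}{4n}\right)}.$$ **Theorem.** There is a constant $c$, independent of $n$, such that for all integers $n\ge 2$ $$\|\mathcal L_n\|\le c(\log n)^3\qquad\text{and}\qquad \|\mathcal L_n^*\|\le c(\log n)^3,$$ where $\|\mathcal L_n\|$ and $\|\mathcal L_n^*\|$ denote the operator norms of $\mathcal L_n,\mathcal L_n^*:C(\triangle_H)\to C(\triangle_H)$. -/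

import Mathlib

namespace TetraInterp

/-! Homogeneous coordinates: a point of the hyperplane `t₁ + t₂ + t₃ + t₄ = 0` of `ℝ⁴` is a function
`Fin 4 → ℝ`; the coordinates `t₁, t₂, t₃, t₄` are `t 0, t 1, t 2, t 3`. -/

/-- The index lattice: integer vectors with coordinate sum zero whose coordinates are all congruent
modulo `4`. -/
def LatticeH : Set (Fin 4 → ℤ) :=
  {k | k 0 + k 1 + k 2 + k 3 = 0 ∧ ∀ i j : Fin 4, k i ≡ k j [ZMOD 4]}

/-- The reference tetrahedron in homogeneous coordinates. -/
def Tetra : Set (Fin 4 → ℝ) :=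
  {t | t 0 + t 1 + t 2 + t 3 = 0 ∧
    (0 ≤ t 0 - t 1 ∧ t 0 - t 1 ≤ 1) ∧ (0 ≤ t 1 - t 2 ∧ t 1 - t 2 ≤ 1) ∧
    (0 ≤ t 2 - t 3 ∧ t 2 - t 3 ≤ 1) ∧ (0 ≤ t 0 - t 3 ∧ t 0 - t 3 ≤ 1)}

theorem isCompact_tetra : IsCompact Tetra := by
  refine (isCompact_Icc (a := fun _ : Fin 4 => (-1 : ℝ)) (b := fun _ => 1)).of_isClosed_subset
    ?_ ?_
  · unfold Tetra
    simp only [Set.ofPred_and]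
    refine (isClosed_eq (by fun_prop) (by fun_prop)).inter (.inter (.inter ?_ ?_)
      (.inter (.inter ?_ ?_) (.inter (.inter ?_ ?_) (.inter ?_ ?_)))) <;>
    exact isClosed_le (by fun_prop) (by fun_prop)
  · rintro t ⟨h0, ⟨h1, h2⟩, ⟨h3, h4⟩, ⟨h5, h6⟩, h7, h8⟩
    refine ⟨fun i => ?_, fun i => ?_⟩ <;> fin_cases i <;> simp <;> linarith

instance : CompactSpace Tetra := isCompact_iff_compactSpace.mp isCompact_tetra

/-- The exponential `φ_k(t) = exp ((π i / 2) k · t)`. -/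
noncomputable def phi (k : Fin 4 → ℤ) (t : Fin 4 → ℝ) : ℂ :=
  Complex.exp ((Real.pi / 2 : ℝ) * Complex.I * ((∑ i, (k i : ℝ) * t i : ℝ) : ℂ))

/-- `P⁺ f(t)`, the average of `f` over the coordinate permutations of `t`. -/
noncomputable def projPlus (f : (Fin 4 → ℝ) → ℂ) (t : Fin 4 → ℝ) : ℂ :=
  (1 / 24) * ∑ σ : Equiv.Perm (Fin 4), f (fun i => t (σ i))

/-- `P⁻ f(t)`, the signed average of `f` over the coordinate permutations of `t`. -/
noncomputable def projMinus (f : (Fin 4 → ℝ) → ℂ) (t : Fin 4 → ℝ) : ℂ :=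
  (1 / 24) * ∑ σ : Equiv.Perm (Fin 4), ((Equiv.Perm.sign σ : ℤ) : ℂ) * f (fun i => t (σ i))

/-- The generalized cosine. -/
noncomputable def TC (k : Fin 4 → ℤ) (t : Fin 4 → ℝ) : ℂ := projPlus (phi k) t

/-- The generalized sine. -/
noncomputable def TS (k : Fin 4 → ℤ) (t : Fin 4 → ℝ) : ℂ := -projMinus (phi k) t

/-- The box `[-4n, 4n]⁴`, which contains all the indices below; it only serves to make the index
sets finite sets (see `mem_Lam` and `mem_LamInt`). -/
noncomputable def box (n : ℕ) : Finset (Fin 4 → ℤ) :=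
  Fintype.piFinset fun _ => Finset.Icc (-(4 * n : ℤ)) (4 * n)

open scoped Classical in
/-- `Λ_n`: the indices `k ∈ ℍ` with `k₄ ≤ k₃ ≤ k₂ ≤ k₁ ≤ k₄ + 4n`. -/
noncomputable def Lam (n : ℕ) : Finset (Fin 4 → ℤ) :=
  (box n).filter fun k =>
    k ∈ LatticeH ∧ k 3 ≤ k 2 ∧ k 2 ≤ k 1 ∧ k 1 ≤ k 0 ∧ k 0 ≤ k 3 + 4 * n

open scoped Classical in
/-- `Λ_n°`: the indices `k ∈ ℍ` with `k₄ < k₃ < k₂ < k₁ < k₄ + 4n`. -/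
noncomputable def LamInt (n : ℕ) : Finset (Fin 4 → ℤ) :=
  (box n).filter fun k =>
    k ∈ LatticeH ∧ k 3 < k 2 ∧ k 2 < k 1 ∧ k 1 < k 0 ∧ k 0 < k 3 + 4 * n

theorem mem_Lam {n : ℕ} {k : Fin 4 → ℤ} :
    k ∈ Lam n ↔ k ∈ LatticeH ∧ k 3 ≤ k 2 ∧ k 2 ≤ k 1 ∧ k 1 ≤ k 0 ∧ k 0 ≤ k 3 + 4 * n := by
  simp only [Lam, Finset.mem_filter, and_iff_right_iff_imp]
  rintro ⟨⟨h0, -⟩, h1, h2, h3, h4⟩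
  simp only [box, Fintype.mem_piFinset, Finset.mem_Icc]
  intro i
  fin_cases i <;> simp <;> omega

theorem mem_LamInt {n : ℕ} {k : Fin 4 → ℤ} :
    k ∈ LamInt n ↔ k ∈ LatticeH ∧ k 3 < k 2 ∧ k 2 < k 1 ∧ k 1 < k 0 ∧ k 0 < k 3 + 4 * n := by
  simp only [LamInt, Finset.mem_filter, and_iff_right_iff_imp]
  rintro ⟨⟨h0, -⟩, h1, h2, h3, h4⟩
  simp only [box, Fintype.mem_piFinset, Finset.mem_Icc]
  intro i
  fin_cases i <;> simp <;> omega

theorem LamInt_subset (n : ℕ) : LamInt n ⊆ Lam n := by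
  intro k hk
  obtain ⟨h, h1, h2, h3, h4⟩ := mem_LamInt.mp hk
  exact mem_Lam.mpr ⟨h, h1.le, h2.le, h3.le, h4.le⟩

/-- `Λ_n^f`, the indices on the open faces. -/
def LamFace (n : ℕ) : Set (Fin 4 → ℤ) :=
  {k | k ∈ LatticeH ∧
    ((k 3 < k 2 ∧ k 2 < k 1 ∧ k 1 < k 0 ∧ k 0 = k 3 + 4 * n) ∨
     (k 3 < k 2 ∧ k 2 < k 1 ∧ k 1 = k 0 ∧ k 0 < k 3 + 4 * n) ∨
     (k 3 < k 2 ∧ k 2 = k 1 ∧ k 1 < k 0 ∧ k 0 < k 3 + 4 * n) ∨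
     (k 3 = k 2 ∧ k 2 < k 1 ∧ k 1 < k 0 ∧ k 0 < k 3 + 4 * n))}

/-- `Λ_n^{e,1}`, the indices on the open edges of the first type. -/
def LamEdge1 (n : ℕ) : Set (Fin 4 → ℤ) :=
  {k | ∃ m : ℤ, 0 < m ∧ m < n ∧
    (k = ![2 * m, 2 * m, -2 * m, -2 * m] ∨
     k = ![2 * m + n, n - 2 * m, n - 2 * m, 2 * m - 3 * n])}

/-- `Λ_n^{e,2}`, the indices on the open edges of the second type. -/
def LamEdge2 (n : ℕ) : Set (Fin 4 → ℤ) :=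
  {k | ∃ m : ℤ, 0 < m ∧ m < n ∧
    (k = ![m, m, m, -3 * m] ∨ k = ![3 * m, -m, -m, -m] ∨
     k = ![n + m, n + m, n - 3 * m, m - 3 * n] ∨
     k = ![3 * n - m, 3 * m - n, -n - m, -n - m])}

open scoped Classical in
/-- The weight `λ_j^{(n)}` of `j ∈ Λ_n`: `24` at interior points, `12` on faces, `6` and `4` on edges
of the first and second type, and `1` at the four vertices
`0`, `(2n,2n,-2n,-2n)`, `(3n,-n,-n,-n)`, `(n,n,n,-3n)` (these are the remaining elements of `Λ_n`). -/
noncomputable def weight (n : ℕ) (j : Fin 4 → ℤ) : ℕ :=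
  if j ∈ LamInt n then 24
  else if j ∈ LamFace n then 12
  else if j ∈ LamEdge1 n then 6
  else if j ∈ LamEdge2 n then 4
  else 1

/-- The node `j / (4n)`. -/
noncomputable def node (n : ℕ) (j : Fin 4 → ℤ) : Fin 4 → ℝ := fun i => (j i : ℝ) / (4 * n)

theorem node_mem {n : ℕ} {j : Fin 4 → ℤ} (hj : j ∈ Lam n) : node n j ∈ Tetra := by
  obtain ⟨⟨h0, -⟩, h1, h2, h3, h4⟩ := mem_Lam.mp hj
  have hn : (0 : ℝ) ≤ 4 * n := by positivity
  have key : ∀ a b : ℤ, b ≤ a → a ≤ b + 4 * n →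
      0 ≤ (a : ℝ) / (4 * n) - b / (4 * n) ∧ (a : ℝ) / (4 * n) - b / (4 * n) ≤ 1 := by
    intro a b hab hba
    rw [← sub_div]
    have e1 : (b : ℝ) ≤ a := by exact_mod_cast hab
    have e2 : (a : ℝ) ≤ b + 4 * n := by exact_mod_cast hba
    exact ⟨div_nonneg (by linarith) hn, div_le_one_of_le₀ (by linarith) hn⟩
  refine ⟨?_, key _ _ (by omega) (by omega), key _ _ (by omega) (by omega),
    key _ _ (by omega) (by omega), key _ _ (by omega) (by omega)⟩
  simp only [node]
  rw [← add_div, ← add_div, ← add_div]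
  have : (j 0 : ℝ) + j 1 + j 2 + j 3 = 0 := by exact_mod_cast h0
  rw [this, zero_div]

theorem continuous_phi (k : Fin 4 → ℤ) : Continuous (phi k) := by
  unfold phi; fun_prop

theorem continuous_TC (k : Fin 4 → ℤ) : Continuous (TC k) := by
  have := continuous_phi k
  unfold TC projPlus; fun_prop

theorem continuous_TS (k : Fin 4 → ℤ) : Continuous (TS k) := by
  have := continuous_phi k
  unfold TS projMinus; fun_prop

/-- The fundamental function `ℓ°_{j,n}`. -/
noncomputable def ellInt (n : ℕ) (j : Fin 4 → ℤ) (t : Fin 4 → ℝ) : ℂ :=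
  144 / (n : ℂ) ^ 3 * ∑ k ∈ LamInt n, TS k t * starRingEnd ℂ (TS k (node n j))

/-- The fundamental function `ℓ^△_{j,n}`. -/
noncomputable def ellStar (n : ℕ) (j : Fin 4 → ℤ) (t : Fin 4 → ℝ) : ℂ :=
  (weight n j : ℂ) / (4 * (n : ℂ) ^ 3) *
    ∑ k ∈ Lam n, (weight n k : ℂ) * TC k t * starRingEnd ℂ (TC k (node n j))

theorem continuous_ellInt (n : ℕ) (j : Fin 4 → ℤ) : Continuous (ellInt n j) := by
  have := continuous_TS
  unfold ellInt; fun_prop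

theorem continuous_ellStar (n : ℕ) (j : Fin 4 → ℤ) : Continuous (ellStar n j) := by
  have := continuous_TC
  unfold ellStar; fun_prop

/-- The interpolation operator `𝓛_n f = ∑_{j ∈ Λ_n°} f(j/4n) ℓ°_{j,n}` on `C(Tetra, ℂ)`. -/
noncomputable def interpInt (n : ℕ) : C(Tetra, ℂ) →L[ℂ] C(Tetra, ℂ) :=
  ∑ j : {j // j ∈ LamInt n},
    (ContinuousMap.evalCLM ℂ (⟨node n j, node_mem (LamInt_subset n j.2)⟩ : Tetra)).smulRight
      ⟨fun t : Tetra => ellInt n j t, (continuous_ellInt n j).comp continuous_subtype_val⟩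

/-- The interpolation operator `𝓛_n^* f = ∑_{j ∈ Λ_n} f(j/4n) ℓ^△_{j,n}` on `C(Tetra, ℂ)`. -/
noncomputable def interpStar (n : ℕ) : C(Tetra, ℂ) →L[ℂ] C(Tetra, ℂ) :=
  ∑ j : {j // j ∈ Lam n},
    (ContinuousMap.evalCLM ℂ (⟨node n j, node_mem j.2⟩ : Tetra)).smulRight
      ⟨fun t : Tetra => ellStar n j t, (continuous_ellStar n j).comp continuous_subtype_val⟩

theorem interpInt_apply (n : ℕ) (f : C(Tetra, ℂ)) (t : Tetra) :
    interpInt n f t = ∑ j : {j // j ∈ LamInt n},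
      f ⟨node n j, node_mem (LamInt_subset n j.2)⟩ * ellInt n j t := by
  simp [interpInt, ContinuousMap.sum_apply]

theorem interpStar_apply (n : ℕ) (f : C(Tetra, ℂ)) (t : Tetra) :
    interpStar n f t = ∑ j : {j // j ∈ Lam n},
      f ⟨node n j, node_mem j.2⟩ * ellStar n j t := by
  simp [interpStar, ContinuousMap.sum_apply]

end TetraInterp

namespace TetraInterp

/-! Both norms are bounded by the supremum over `t` of the Lebesgue function, the sum over the nodes
of the absolute values of the fundamental functions. Write each index as `k = 4m - (∑ m)(1,1,1,1)`
with `m` in `ℕ⁴` having least entry zero. Where the coordinates of `u` sum to zero, `φ_k(u)` becomes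
the product of the `exp(2πi u_i)^{m_i}` (`phi_latticeOf`), and the `S₄`-orbit of `Λ_n` becomes the
set `cube n` of such `m` with entries at most `n`.

The products of generalized cosines or sines are permutation invariant, so a kernel sum over `Λ_n`
unfolds to one over `cube n` (`sum_cube_eq`). The coefficient acquired is the weight times the
stabilizer order, which depends only on which entries are `0`, `n` or strictly between
(`weight_latticeOf`). For each of the 81 patterns the sum factors into one-dimensional geometric
sums; the factor at an entry forced to be `0` is trivial, leaving a product of three Dirichlet-type
kernels (`norm_kernel_le`).

Three coordinates determine a node, so the sum over nodes is at most a product of three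
one-dimensional sums, each `O(n log n)` (`sum_majorant_le`, `sum_prodMajorant_le`). The factor
`1/n³` in the fundamental functions then leaves `(log n)³`. -/

/-! ### Unfolding sums over `Λ_n` to sums over `cube n` -/

/-- The index `4 m - (∑ m) (1,1,1,1)` attached to `m`. -/
def latticeOf (m : Fin 4 → ℕ) : Fin 4 → ℤ := fun i => 4 * m i - ∑ l, (m l : ℤ)

/-- Representatives `m` of the indices in the `S₄`-orbit of `Λ_n`: entries at most `n`, some entry
zero. -/
def cube (n : ℕ) : Finset (Fin 4 → ℕ) :=
  (Fintype.piFinset fun _ => Finset.range (n + 1)).filter fun m => ∃ i, m i = 0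

theorem mem_cube {n : ℕ} {m : Fin 4 → ℕ} : m ∈ cube n ↔ (∀ i, m i ≤ n) ∧ ∃ i, m i = 0 := by
  simp [cube]

open scoped Classical in
/-- The decreasing elements of `cube n`. -/
noncomputable def chamber (n : ℕ) : Finset (Fin 4 → ℕ) := (cube n).filter fun m => Antitone m

theorem mem_chamber {n : ℕ} {m : Fin 4 → ℕ} : m ∈ chamber n ↔ m ∈ cube n ∧ Antitone m := by
  simp [chamber]

theorem mem_chamber_iff {n : ℕ} {m : Fin 4 → ℕ} :
    m ∈ chamber n ↔ m 0 ≤ n ∧ m 1 ≤ m 0 ∧ m 2 ≤ m 1 ∧ m 3 ≤ m 2 ∧ m 3 = 0 := by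
  rw [mem_chamber, mem_cube, Fin.antitone_iff_succ_le]
  simp [Fin.forall_fin_succ, Fin.exists_fin_succ]
  omega

theorem latticeOf_comp (m : Fin 4 → ℕ) (σ : Equiv.Perm (Fin 4)) :
    latticeOf (m ∘ σ) = latticeOf m ∘ σ := by
  funext i
  simp [latticeOf, Equiv.sum_comp σ fun l => (m l : ℤ)]

theorem sum_Lam {n : ℕ} (F : (Fin 4 → ℤ) → ℂ) :
    ∑ k ∈ Lam n, F k = ∑ m ∈ chamber n, F (latticeOf m) := by
  symm
  -- A decreasing `m` with least entry zero has `m 3 = 0`, so `k i - k 3 = 4 * m i` recovers `m`.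
  refine Finset.sum_nbij' latticeOf (fun k i => ((k i - k 3) / 4).toNat) ?_ ?_ ?_ ?_ ?_
  · intro m hm
    rw [mem_chamber_iff] at hm
    rw [mem_Lam]
    simp only [LatticeH, Set.mem_ofPred_eq, latticeOf, Fin.sum_univ_four, Int.ModEq]
    refine ⟨⟨by ring, fun i j => ?_⟩, ?_⟩ <;> omega
  · intro k hk
    rw [mem_Lam] at hk
    rw [mem_chamber_iff]
    omega
  · intro m hm
    rw [mem_chamber_iff] at hm
    funext i
    simp only [latticeOf]
    omega
  · intro k hk
    rw [mem_Lam] at hk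
    obtain ⟨⟨h0, h⟩, h1⟩ := hk
    have a0 := h 0 3
    have a1 := h 1 3
    have a2 := h 2 3
    simp only [Int.ModEq] at a0 a1 a2
    funext i
    simp only [latticeOf, Fin.sum_univ_four]
    fin_cases i <;> simp <;> omega
  · intro m _
    rfl

/-- The number of coordinate permutations fixing `m`. -/
def stab (m : Fin 4 → ℕ) : ℕ :=
  (Finset.univ.filter fun σ : Equiv.Perm (Fin 4) => m ∘ σ = m).card

theorem stab_pos (m : Fin 4 → ℕ) : 0 < stab m :=
  Finset.card_pos.mpr ⟨1, by simp⟩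

theorem stab_comp (m : Fin 4 → ℕ) (ρ : Equiv.Perm (Fin 4)) : stab (m ∘ ρ) = stab m := by
  unfold stab
  refine Finset.card_bij' (fun σ _ => ρ * σ * ρ⁻¹) (fun σ _ => ρ⁻¹ * σ * ρ) ?_ ?_ ?_ ?_
  · intro σ hσ
    simp only [Finset.mem_filter, Finset.mem_univ, true_and] at hσ ⊢
    funext i
    simpa using congrFun hσ (ρ⁻¹ i)
  · intro σ hσ
    simp only [Finset.mem_filter, Finset.mem_univ, true_and] at hσ ⊢
    funext i
    simpa using congrFun hσ (ρ i)
  · intro σ _; group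
  · intro σ _; group

theorem comp_mem_cube {n : ℕ} {m : Fin 4 → ℕ} (σ : Equiv.Perm (Fin 4)) :
    m ∘ σ ∈ cube n ↔ m ∈ cube n := by
  simp only [mem_cube, Function.comp_apply]
  rw [σ.forall_congr_left, σ.exists_congr_left]
  simp

-- The permutations that put `m` in decreasing order form a coset of its stabilizer.
open scoped Classical in
theorem card_sorting {n : ℕ} {m : Fin 4 → ℕ} (hm : m ∈ cube n) :
    (Finset.univ.filter fun σ : Equiv.Perm (Fin 4) => m ∘ σ ∈ chamber n).card = stab m := by
  set d : Fin 4 → ℕᵒᵈ := OrderDual.toDual ∘ m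
  set τ := Tuple.sort d
  have hτ : Monotone (d ∘ τ) := Tuple.monotone_sort d
  have key : ∀ σ : Equiv.Perm (Fin 4), m ∘ σ ∈ chamber n ↔ m ∘ σ = m ∘ τ := by
    intro σ
    rw [mem_chamber, comp_mem_cube]
    constructor
    · rintro ⟨-, h⟩
      have h' : Monotone (d ∘ σ) := fun a b hab => h hab
      exact Tuple.unique_monotone (f := d) h' hτ
    · intro h
      refine ⟨hm, ?_⟩
      rw [h]
      exact fun a b hab => hτ hab
  unfold stab
  refine Finset.card_bij' (fun σ _ => σ * τ⁻¹) (fun σ _ => σ * τ) ?_ ?_ ?_ ?_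
  · intro σ hσ
    simp only [Finset.mem_filter, Finset.mem_univ, true_and, key] at hσ ⊢
    funext i
    simpa using congrFun hσ (τ⁻¹ i)
  · intro σ hσ
    simp only [Finset.mem_filter, Finset.mem_univ, true_and, key] at hσ ⊢
    funext i
    simpa using congrFun hσ (τ i)
  · intro σ _; group
  · intro σ _; group

/-- Orbit decomposition of a sum of a permutation invariant function. -/
theorem sum_cube_eq {n : ℕ} (F : (Fin 4 → ℕ) → ℂ)
    (hF : ∀ (σ : Equiv.Perm (Fin 4)) m, F (m ∘ σ) = F m) :
    ∑ m ∈ cube n, F m = 24 * ∑ m ∈ chamber n, F m / stab m := by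
  classical
  -- Each term is shared equally among the permutations sorting `m`. After exchanging the sums, each
  -- of the 24 permutations contributes the same sum over `chamber n`.
  have h1 : ∀ m ∈ cube n, F m =
      ∑ σ : Equiv.Perm (Fin 4), if m ∘ σ ∈ chamber n then F m / stab m else 0 := by
    intro m hm
    rw [← Finset.sum_filter, Finset.sum_const, card_sorting hm, nsmul_eq_mul]
    have : (stab m : ℂ) ≠ 0 := by exact_mod_cast (stab_pos m).ne'
    field_simp
  have h2 : ∀ σ : Equiv.Perm (Fin 4),
      ∑ m ∈ cube n, (if m ∘ σ ∈ chamber n then F m / stab m else 0)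
        = ∑ m ∈ chamber n, F m / stab m := by
    intro σ
    rw [← Finset.sum_filter]
    refine Finset.sum_nbij' (fun m => m ∘ σ) (fun m => m ∘ σ.symm) ?_ ?_ ?_ ?_ ?_
    · intro m hm
      exact (Finset.mem_filter.mp hm).2
    · intro m hm
      rw [Finset.mem_filter]
      refine ⟨(comp_mem_cube _).mpr (mem_chamber.mp hm).1, ?_⟩
      simpa [Function.comp_assoc] using hm
    · intro m _
      simp [Function.comp_assoc]
    · intro m _
      simp [Function.comp_assoc]
    · intro m _
      rw [hF, stab_comp]
  rw [Finset.sum_congr rfl h1, Finset.sum_comm, Finset.sum_congr rfl fun σ _ => h2 σ,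
    Finset.sum_const, Finset.card_univ, Fintype.card_perm]
  simp [Nat.factorial]

/-! ### Weights in terms of patterns -/

/-- The position of each entry of `m` in `{0} ∪ (0, n) ∪ {n}`. -/
def pattern (n : ℕ) (m : Fin 4 → ℕ) : Fin 4 → Fin 3 :=
  fun i => if m i = 0 then 0 else if m i = n then 2 else 1

/-- The number of entries of a pattern equal to `a`. -/
def patCount (P : Fin 4 → Fin 3) (a : Fin 3) : ℕ := (Finset.univ.filter fun i => P i = a).card

theorem patCount_comp (P : Fin 4 → Fin 3) (σ : Equiv.Perm (Fin 4)) (a : Fin 3) :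
    patCount (P ∘ σ) a = patCount P a := by
  unfold patCount
  exact Finset.card_bij' (fun i _ => σ i) (fun i _ => σ.symm i)
    (by simp) (by simp) (by simp) (by simp)

/-- The weight, multiplied by the order of the stabilizer, as a function of the pattern. -/
def patWeight (P : Fin 4 → Fin 3) : ℕ :=
  if patCount P 2 = 0 then 24 else 24 / (patCount P 0 + patCount P 2).choose (patCount P 0)

theorem patWeight_comp (P : Fin 4 → Fin 3) (σ : Equiv.Perm (Fin 4)) :
    patWeight (P ∘ σ) = patWeight P := by
  simp only [patWeight, patCount_comp]

theorem patWeight_le (P : Fin 4 → Fin 3) : patWeight P ≤ 24 := by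
  unfold patWeight
  split_ifs
  · exact le_rfl
  · exact Nat.div_le_self _ _

theorem stab_eq {m : Fin 4 → ℕ} (b : Fin 4 → Fin 4) (h : ∀ i j, m i = m j ↔ b i = b j) :
    stab m = (Finset.univ.filter fun σ : Equiv.Perm (Fin 4) => ∀ i, b (σ i) = b i).card := by
  unfold stab
  congr 1
  ext σ
  simp only [Finset.mem_filter, Finset.mem_univ, true_and, funext_iff, Function.comp_apply, h]

theorem stab_eq_of_antitone {m : Fin 4 → ℕ} (b : Fin 4 → Fin 4)
    (hm : m 1 ≤ m 0 ∧ m 2 ≤ m 1 ∧ m 3 ≤ m 2)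
    (hb : b 0 ≤ b 1 ∧ b 1 ≤ b 2 ∧ b 2 ≤ b 3)
    (h1 : m 0 = m 1 ↔ b 0 = b 1) (h2 : m 1 = m 2 ↔ b 1 = b 2) (h3 : m 2 = m 3 ↔ b 2 = b 3) :
    stab m = (Finset.univ.filter fun σ : Equiv.Perm (Fin 4) => ∀ i, b (σ i) = b i).card := by
  refine stab_eq b fun i j => ?_
  simp only [Fin.ext_iff, Fin.le_def] at *
  fin_cases i <;> fin_cases j <;> simp <;> omega

theorem pattern_eq (n : ℕ) (m : Fin 4 → ℕ) : pattern n m =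
    ![if m 0 = 0 then 0 else if m 0 = n then 2 else 1, if m 1 = 0 then 0 else if m 1 = n then 2 else 1,
      if m 2 = 0 then 0 else if m 2 = n then 2 else 1,
      if m 3 = 0 then 0 else if m 3 = n then 2 else 1] := by
  funext i
  fin_cases i <;> rfl

theorem latticeOf_mem {n : ℕ} {m : Fin 4 → ℕ} (hm : m ∈ chamber n) : latticeOf m ∈ LatticeH := by
  rw [mem_chamber_iff] at hm
  simp only [LatticeH, Set.mem_ofPred_eq, latticeOf, Fin.sum_univ_four, Int.ModEq]
  refine ⟨by ring, fun i j => ?_⟩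
  omega

theorem latticeOf_mem_LamInt {n : ℕ} {m : Fin 4 → ℕ} (hm : m ∈ chamber n) :
    latticeOf m ∈ LamInt n ↔ m 1 < m 0 ∧ m 2 < m 1 ∧ m 3 < m 2 ∧ m 0 < n := by
  have h := latticeOf_mem hm
  rw [mem_chamber_iff] at hm
  rw [mem_LamInt]
  simp only [h, true_and, latticeOf]
  omega

theorem latticeOf_mem_LamFace {n : ℕ} {m : Fin 4 → ℕ} (hm : m ∈ chamber n) :
    latticeOf m ∈ LamFace n ↔
    ((m 3 < m 2 ∧ m 2 < m 1 ∧ m 1 < m 0 ∧ m 0 = n) ∨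
     (m 3 < m 2 ∧ m 2 < m 1 ∧ m 1 = m 0 ∧ m 0 < n) ∨
     (m 3 < m 2 ∧ m 2 = m 1 ∧ m 1 < m 0 ∧ m 0 < n) ∨
     (m 3 = m 2 ∧ m 2 < m 1 ∧ m 1 < m 0 ∧ m 0 < n)) := by
  have h := latticeOf_mem hm
  rw [mem_chamber_iff] at hm
  simp only [LamFace, Set.mem_ofPred_eq, h, true_and, latticeOf]
  omega

theorem vec_eq (k : Fin 4 → ℤ) (a b c d : ℤ) :
    k = ![a, b, c, d] ↔ k 0 = a ∧ k 1 = b ∧ k 2 = c ∧ k 3 = d := by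
  simp [funext_iff, Fin.forall_fin_succ]

theorem latticeOf_mem_LamEdge1 {n : ℕ} {m : Fin 4 → ℕ} (hm : m ∈ chamber n) :
    latticeOf m ∈ LamEdge1 n ↔
    ((m 0 = m 1 ∧ 0 < m 0 ∧ m 0 < n ∧ m 2 = 0) ∨
     (m 0 = n ∧ m 1 = m 2 ∧ 0 < m 1 ∧ m 1 < n)) := by
  rw [mem_chamber_iff] at hm
  simp only [LamEdge1, Set.mem_ofPred_eq, vec_eq, latticeOf, Fin.sum_univ_four]
  constructor
  · rintro ⟨l, h⟩
    omega
  · rintro (h | h)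
    · exact ⟨m 0, by omega⟩
    · exact ⟨n - m 1, by omega⟩

theorem latticeOf_mem_LamEdge2 {n : ℕ} {m : Fin 4 → ℕ} (hm : m ∈ chamber n) :
    latticeOf m ∈ LamEdge2 n ↔
    ((m 0 = m 1 ∧ 0 < m 0 ∧ m 0 < n ∧ m 1 = m 2) ∨
     (m 1 = 0 ∧ 0 < m 0 ∧ m 0 < n) ∨
     (m 0 = n ∧ m 1 = n ∧ 0 < m 2 ∧ m 2 < n) ∨
     (m 0 = n ∧ m 2 = 0 ∧ 0 < m 1 ∧ m 1 < n)) := by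
  rw [mem_chamber_iff] at hm
  simp only [LamEdge2, Set.mem_ofPred_eq, vec_eq, latticeOf, Fin.sum_univ_four]
  constructor
  · rintro ⟨l, h⟩
    omega
  · rintro (h | h | h | h)
    · exact ⟨m 0, by omega⟩
    · exact ⟨m 0, by omega⟩
    · exact ⟨n - m 2, by omega⟩
    · exact ⟨m 1, by omega⟩

theorem weight_aux {n : ℕ} {m : Fin 4 → ℕ} (W s : ℕ) (b : Fin 4 → Fin 4) (p₀ p₁ p₂ p₃ : Fin 3)
    (hm : m 1 ≤ m 0 ∧ m 2 ≤ m 1 ∧ m 3 ≤ m 2) (hw : weight n (latticeOf m) = W)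
    (hb : b 0 ≤ b 1 ∧ b 1 ≤ b 2 ∧ b 2 ≤ b 3)
    (hs : (Finset.univ.filter fun σ : Equiv.Perm (Fin 4) => ∀ i, b (σ i) = b i).card = s)
    (hW : W * s = patWeight ![p₀, p₁, p₂, p₃])
    (h1 : m 0 = m 1 ↔ b 0 = b 1) (h2 : m 1 = m 2 ↔ b 1 = b 2) (h3 : m 2 = m 3 ↔ b 2 = b 3)
    (h4 : (if m 0 = 0 then 0 else if m 0 = n then 2 else 1) = p₀)
    (h5 : (if m 1 = 0 then 0 else if m 1 = n then 2 else 1) = p₁)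
    (h6 : (if m 2 = 0 then 0 else if m 2 = n then 2 else 1) = p₂)
    (h7 : (if m 3 = 0 then 0 else if m 3 = n then 2 else 1) = p₃) :
    weight n (latticeOf m) * stab m = patWeight (pattern n m) := by
  rw [pattern_eq, h4, h5, h6, h7, ← hW, hw, stab_eq_of_antitone b hm hb h1 h2 h3, hs]

/-- With `c₀` zeros and `c₂` entries `n`, the weight is `24` divided by `(c₀ + c₂)!` and by the
factorials of the multiplicities of the intermediate values, since `0` and `n` are identified under
affine reflections. The stabilizer has order `c₀! c₂!` times those same factorials, so the product
is `24 / (c₀ + c₂).choose c₀`, free of the intermediate multiplicities. -/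
theorem weight_latticeOf {n : ℕ} (hn : 1 ≤ n) {m : Fin 4 → ℕ} (hm : m ∈ chamber n) :
    weight n (latticeOf m) * stab m = patWeight (pattern n m) := by
  have a1 := latticeOf_mem_LamInt hm
  have a2 := latticeOf_mem_LamFace hm
  have a3 := latticeOf_mem_LamEdge1 hm
  have a4 := latticeOf_mem_LamEdge2 hm
  rw [mem_chamber_iff] at hm
  obtain ⟨g0, g1, g2, g3, g4⟩ := hm
  have hw := weight.eq_1 n (latticeOf m)
  simp only [a1, a2, a3, a4] at hw
  have A := fun W s b p₀ p₁ p₂ p₃ => weight_aux (n := n) (m := m) W s b p₀ p₁ p₂ p₃ ⟨g1, g2, g3⟩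
  rw [hw] at A ⊢
  clear a1 a2 a3 a4 hw
  generalize stab m = S at *
  generalize patWeight (pattern n m) = Q at *
  generalize m 0 = x at *
  generalize m 1 = y at *
  generalize m 2 = z at *
  generalize m 3 = w at *
  -- The cases record which inequalities in `n ≥ x ≥ y ≥ z ≥ w = 0` are equalities; all four at once
  -- would force `n = 0`. Each use of `A` supplies the weight, the stabilizer order, labels of the
  -- blocks of equal entries, and the pattern.
  rcases g0.eq_or_lt with e4 | e4 <;> rcases g1.eq_or_lt with e1 | e1 <;>
    rcases g2.eq_or_lt with e2 | e2 <;> rcases g3.eq_or_lt with e3 | e3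
  · omega
  · refine A 1 6 ![0, 0, 0, 1] 2 2 2 0 ?_ (by decide) (by decide)
      (by decide) ?_ ?_ ?_ ?_ ?_ ?_ ?_
    all_goals first | (split_ifs <;> first | rfl | omega) | (simp; omega)
  · refine A 1 4 ![0, 0, 1, 1] 2 2 0 0 ?_ (by decide) (by decide)
      (by decide) ?_ ?_ ?_ ?_ ?_ ?_ ?_
    all_goals first | (split_ifs <;> first | rfl | omega) | (simp; omega)
  · refine A 4 2 ![0, 0, 1, 2] 2 2 1 0 ?_ (by decide) (by decide)
      (by decide) ?_ ?_ ?_ ?_ ?_ ?_ ?_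
    all_goals first | (split_ifs <;> first | rfl | omega) | (simp; omega)
  · refine A 1 6 ![0, 1, 1, 1] 2 0 0 0 ?_ (by decide) (by decide)
      (by decide) ?_ ?_ ?_ ?_ ?_ ?_ ?_
    all_goals first | (split_ifs <;> first | rfl | omega) | (simp; omega)
  · refine A 6 2 ![0, 1, 1, 2] 2 1 1 0 ?_ (by decide) (by decide)
      (by decide) ?_ ?_ ?_ ?_ ?_ ?_ ?_
    all_goals first | (split_ifs <;> first | rfl | omega) | (simp; omega)
  · refine A 4 2 ![0, 1, 2, 2] 2 1 0 0 ?_ (by decide) (by decide)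
      (by decide) ?_ ?_ ?_ ?_ ?_ ?_ ?_
    all_goals first | (split_ifs <;> first | rfl | omega) | (simp; omega)
  · refine A 12 1 ![0, 1, 2, 3] 2 1 1 0 ?_ (by decide) (by decide)
      (by decide) ?_ ?_ ?_ ?_ ?_ ?_ ?_
    all_goals first | (split_ifs <;> first | rfl | omega) | (simp; omega)
  · refine A 1 24 ![0, 0, 0, 0] 0 0 0 0 ?_ (by decide) (by decide)
      (by decide) ?_ ?_ ?_ ?_ ?_ ?_ ?_
    all_goals first | (split_ifs <;> first | rfl | omega) | (simp; omega)
  · refine A 4 6 ![0, 0, 0, 1] 1 1 1 0 ?_ (by decide) (by decide)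
      (by decide) ?_ ?_ ?_ ?_ ?_ ?_ ?_
    all_goals first | (split_ifs <;> first | rfl | omega) | (simp; omega)
  · refine A 6 4 ![0, 0, 1, 1] 1 1 0 0 ?_ (by decide) (by decide)
      (by decide) ?_ ?_ ?_ ?_ ?_ ?_ ?_
    all_goals first | (split_ifs <;> first | rfl | omega) | (simp; omega)
  · refine A 12 2 ![0, 0, 1, 2] 1 1 1 0 ?_ (by decide) (by decide)
      (by decide) ?_ ?_ ?_ ?_ ?_ ?_ ?_
    all_goals first | (split_ifs <;> first | rfl | omega) | (simp; omega)
  · refine A 4 6 ![0, 1, 1, 1] 1 0 0 0 ?_ (by decide) (by decide)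
      (by decide) ?_ ?_ ?_ ?_ ?_ ?_ ?_
    all_goals first | (split_ifs <;> first | rfl | omega) | (simp; omega)
  · refine A 12 2 ![0, 1, 1, 2] 1 1 1 0 ?_ (by decide) (by decide)
      (by decide) ?_ ?_ ?_ ?_ ?_ ?_ ?_
    all_goals first | (split_ifs <;> first | rfl | omega) | (simp; omega)
  · refine A 12 2 ![0, 1, 2, 2] 1 1 0 0 ?_ (by decide) (by decide)
      (by decide) ?_ ?_ ?_ ?_ ?_ ?_ ?_
    all_goals first | (split_ifs <;> first | rfl | omega) | (simp; omega)
  · refine A 24 1 ![0, 1, 2, 3] 1 1 1 0 ?_ (by decide) (by decide)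
      (by decide) ?_ ?_ ?_ ?_ ?_ ?_ ?_
    all_goals first | (split_ifs <;> first | rfl | omega) | (simp; omega)

/-! ### Symmetrized exponentials, for the trivial and the sign character together -/

/-- The average of `φ_k` over the coordinate permutations, twisted by a sign character `χ`. -/
noncomputable def alt (χ : Equiv.Perm (Fin 4) →* ℤˣ) (k : Fin 4 → ℤ) (t : Fin 4 → ℝ) : ℂ :=
  (1 / 24) * ∑ σ : Equiv.Perm (Fin 4), ((χ σ : ℤ) : ℂ) * phi k (fun i => t (σ i))

theorem TC_eq_alt (k : Fin 4 → ℤ) (t : Fin 4 → ℝ) : TC k t = alt 1 k t := by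
  simp [TC, projPlus, alt]

theorem TS_eq_alt (k : Fin 4 → ℤ) (t : Fin 4 → ℝ) : TS k t = -alt Equiv.Perm.sign k t := rfl

theorem phi_comp (k : Fin 4 → ℤ) (t : Fin 4 → ℝ) (ρ : Equiv.Perm (Fin 4)) :
    phi (k ∘ ρ) t = phi k (t ∘ ρ.symm) := by
  unfold phi
  congr 3
  rw [← Equiv.sum_comp ρ.symm fun i => (((k ∘ ρ) i : ℤ) : ℝ) * t i]
  simp

theorem unit_cast_mul_self (u : ℤˣ) : ((u : ℤ) : ℂ) * ((u : ℤ) : ℂ) = 1 := by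
  rcases Int.units_eq_one_or u with rfl | rfl <;> simp

theorem norm_unit_cast (u : ℤˣ) : ‖((u : ℤ) : ℂ)‖ = 1 := by
  rcases Int.units_eq_one_or u with rfl | rfl <;> simp

theorem alt_comp (χ : Equiv.Perm (Fin 4) →* ℤˣ) (k : Fin 4 → ℤ) (t : Fin 4 → ℝ)
    (ρ : Equiv.Perm (Fin 4)) : alt χ (k ∘ ρ) t = ((χ ρ : ℤ) : ℂ) * alt χ k t := by
  unfold alt
  rw [mul_left_comm]
  congr 1
  rw [Finset.mul_sum]
  refine (Equiv.sum_comp (Equiv.mulRight ρ) fun σ : Equiv.Perm (Fin 4) =>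
    ((χ σ : ℤ) : ℂ) * phi (k ∘ ρ) (fun i => t (σ i))).symm.trans ?_
  refine Finset.sum_congr rfl fun σ _ => ?_
  rw [phi_comp]
  simp only [Equiv.coe_mulRight, map_mul, Units.val_mul, Int.cast_mul]
  have : ((fun i => t ((σ * ρ) i)) ∘ ρ.symm) = fun i => t (σ i) := by
    funext i; simp
  rw [this]
  ring

/-- The character enters squared and takes values `±1`, so it cancels even in the alternating case.
-/
theorem alt_mul_conj_comp (χ : Equiv.Perm (Fin 4) →* ℤˣ) (k : Fin 4 → ℤ) (t s : Fin 4 → ℝ)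
    (ρ : Equiv.Perm (Fin 4)) :
    alt χ (k ∘ ρ) t * starRingEnd ℂ (alt χ (k ∘ ρ) s) = alt χ k t * starRingEnd ℂ (alt χ k s) := by
  rw [alt_comp, alt_comp, map_mul, map_intCast]
  linear_combination (alt χ k t * starRingEnd ℂ (alt χ k s)) * unit_cast_mul_self (χ ρ)

theorem alt_sign_eq_zero {k : Fin 4 → ℤ} {i j : Fin 4} (hij : i ≠ j) (h : k i = k j)
    (t : Fin 4 → ℝ) : alt Equiv.Perm.sign k t = 0 := by
  have h1 := alt_comp Equiv.Perm.sign k t (Equiv.swap i j)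
  have h2 : k ∘ Equiv.swap i j = k := by
    funext l
    simp only [Function.comp_apply, Equiv.swap_apply_def]
    split_ifs with ha hb
    · rw [ha, h]
    · rw [hb, h]
    · rfl
  rw [h2, Equiv.Perm.sign_swap hij] at h1
  simp only [Units.val_neg, Units.val_one, Int.cast_neg, Int.cast_one, neg_mul, one_mul] at h1
  exact self_eq_neg.mp h1

/-- The exponential `x ↦ exp (2 π i x)`. -/
noncomputable def unitExp (x : ℝ) : ℂ := Complex.exp ((2 * Real.pi * x : ℝ) * Complex.I)

theorem norm_unitExp (x : ℝ) : ‖unitExp x‖ = 1 := Complex.norm_exp_ofReal_mul_I _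

/-- The shift by a multiple of `(1,1,1,1)` is invisible to a `u` with coordinate sum zero, so the
four variables separate. -/
theorem phi_latticeOf (m : Fin 4 → ℕ) {u : Fin 4 → ℝ} (hu : ∑ i, u i = 0) :
    phi (latticeOf m) u = ∏ i, unitExp (u i) ^ m i := by
  have h : (∑ i, (latticeOf m i : ℝ) * u i) = ∑ i, 4 * (m i * u i) := by
    have : ∀ i, (latticeOf m i : ℝ) * u i = 4 * (m i * u i) - (∑ l, (m l : ℝ)) * u i := by
      intro i
      simp only [latticeOf]
      push_cast
      ring
    simp only [this, Finset.sum_sub_distrib, ← Finset.mul_sum, hu, mul_zero, sub_zero]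
  unfold phi unitExp
  simp only [← Complex.exp_nat_mul]
  rw [← Complex.exp_sum, h]
  congr 1
  push_cast
  rw [Finset.mul_sum]
  refine Finset.sum_congr rfl fun i _ => ?_
  ring

theorem phi_mul_conj (k : Fin 4 → ℤ) (a b : Fin 4 → ℝ) :
    phi k a * starRingEnd ℂ (phi k b) = phi k (fun i => a i - b i) := by
  unfold phi
  rw [← Complex.exp_conj, ← Complex.exp_add]
  congr 1
  simp only [map_mul, Complex.conj_ofReal, Complex.conj_I]
  simp only [mul_sub, Finset.sum_sub_distrib]
  push_cast
  ring

theorem alt_mul_conj (χ : Equiv.Perm (Fin 4) →* ℤˣ) (k : Fin 4 → ℤ) (t s : Fin 4 → ℝ) :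
    alt χ k t * starRingEnd ℂ (alt χ k s) = (1 / 576) * ∑ σ : Equiv.Perm (Fin 4),
      ∑ τ : Equiv.Perm (Fin 4), ((χ σ : ℤ) : ℂ) * ((χ τ : ℤ) : ℂ) *
        phi k (fun i => t (σ i) - s (τ i)) := by
  unfold alt
  simp only [map_mul, map_sum, map_intCast, ← phi_mul_conj]
  rw [mul_mul_mul_comm, Finset.sum_mul_sum]
  congr 1
  · rw [map_div₀, map_one, map_ofNat]
    norm_num
  · refine Finset.sum_congr rfl fun σ _ => Finset.sum_congr rfl fun τ _ => ?_
    ring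

/-! ### Bounds for the one- and three-dimensional kernels -/

/-- A majorant of the one-dimensional Dirichlet kernels of length `n` on `[-2, 2]`. -/
noncomputable def majorant (n : ℕ) (u : ℝ) : ℝ :=
  ∑ p ∈ Finset.Icc (-2 : ℤ) 2, 5 * n / (1 + n * |u - p|)

theorem majorant_term_nonneg (n : ℕ) (u : ℝ) (p : ℤ) : 0 ≤ 5 * n / (1 + n * |u - p|) := by
  positivity

theorem majorant_nonneg (n : ℕ) (u : ℝ) : 0 ≤ majorant n u :=
  Finset.sum_nonneg fun p _ => majorant_term_nonneg n u p

theorem one_le_majorant {n : ℕ} (hn : 1 ≤ n) {u : ℝ} (hu : |u| ≤ 2) : 1 ≤ majorant n u := by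
  have h : (5 * n / (1 + n * |u - (0 : ℤ)|) : ℝ) ≤ majorant n u :=
    Finset.single_le_sum (f := fun p : ℤ => (5 * n / (1 + n * |u - p|) : ℝ))
      (fun p _ => majorant_term_nonneg n u p) (by simp)
  refine le_trans ?_ h
  have hn' : (1 : ℝ) ≤ n := by exact_mod_cast hn
  rw [Int.cast_zero, sub_zero, one_le_div (by positivity)]
  nlinarith

theorem norm_unitExp_sub_one (u : ℝ) (p : ℤ) (h : |u - p| ≤ 1 / 2) :
    4 * |u - p| ≤ ‖unitExp u - 1‖ := by
  have h1 : ‖unitExp u - 1‖ = 2 * |Real.sin (Real.pi * (u - p))| := by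
    have h2 : Real.pi * (u - p) = Real.pi * u - p * Real.pi := by ring
    have h3 : 2 * Real.pi * u / 2 = Real.pi * u := by ring
    unfold unitExp
    rw [mul_comm, Complex.norm_exp_I_mul_ofReal_sub_one, h2, Real.sin_sub_int_mul_pi, h3,
      abs_mul, abs_neg_one_zpow, one_mul, norm_mul]
    simp
  have h2 : |Real.pi * (u - p)| = Real.pi * |u - p| := by
    rw [abs_mul, abs_of_pos Real.pi_pos]
  have h3 := Real.mul_abs_le_abs_sin (x := Real.pi * (u - p)) (by
    rw [h2]; nlinarith [Real.pi_pos])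
  rw [h2] at h3
  have h4 : 2 / Real.pi * (Real.pi * |u - p|) = 2 * |u - p| := by
    have := Real.pi_ne_zero
    field_simp
  rw [h1]
  linarith

/-- If `d` is the distance from `u` to the nearest integer, the trivial bound `n` and the closed
form of the geometric sum give `‖S‖ ≤ n` and `4 d ‖S‖ ≤ 2`, hence `‖S‖ (1 + n d) ≤ 3n/2`. The
nearest integer is one of the five centres in `majorant` because `|u| ≤ 2`. -/
theorem norm_geom_sum_le {n : ℕ} (hn : 1 ≤ n) {u : ℝ} (hu : |u| ≤ 2) :
    ‖∑ l ∈ Finset.Ioo 0 n, unitExp u ^ l‖ ≤ majorant n u := by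
  set d : ℝ := |u - round u| with hd
  have hd2 : d ≤ 1 / 2 := abs_sub_round u
  have hd0 : 0 ≤ d := abs_nonneg _
  have hn' : (1 : ℝ) ≤ n := by exact_mod_cast hn
  have hround : round u ∈ Finset.Icc (-2 : ℤ) 2 := by
    have h1 := abs_le.mp (abs_sub_round u)
    have h2 := abs_le.mp hu
    have h3 : ((-3 : ℤ) : ℝ) < round u := by push_cast; linarith
    have h4 : (round u : ℝ) < (3 : ℤ) := by push_cast; linarith
    have h5 := Int.cast_lt.mp h3
    have h6 := Int.cast_lt.mp h4
    rw [Finset.mem_Icc]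
    omega
  have h : (5 * n / (1 + n * d) : ℝ) ≤ majorant n u :=
    Finset.single_le_sum (f := fun p : ℤ => (5 * n / (1 + n * |u - p|) : ℝ))
      (fun p _ => majorant_term_nonneg n u p) hround
  refine le_trans ?_ h
  rw [le_div_iff₀ (by positivity)]
  set S := ∑ l ∈ Finset.Ioo 0 n, unitExp u ^ l with hS
  have b1 : ‖S‖ ≤ n := by
    refine (norm_sum_le _ _).trans ?_
    simp only [norm_pow, norm_unitExp, one_pow, Finset.sum_const, Nat.card_Ioo, nsmul_eq_mul, mul_one]
    exact_mod_cast (by omega : n - 0 - 1 ≤ n)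
  have b2 : ‖S‖ * (4 * d) ≤ 2 := by
    have e : S * (unitExp u - 1) = unitExp u ^ n - unitExp u := by
      have := geom_sum_Ico_mul (unitExp u) hn
      rwa [pow_one] at this
    calc ‖S‖ * (4 * d) ≤ ‖S‖ * ‖unitExp u - 1‖ := by
          gcongr
          exact norm_unitExp_sub_one u _ hd2
      _ = ‖unitExp u ^ n - unitExp u‖ := by rw [← norm_mul, e]
      _ ≤ ‖unitExp u ^ n‖ + ‖unitExp u‖ := norm_sub_le _ _
      _ = 2 := by rw [norm_pow, norm_unitExp, one_pow]; norm_num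
  nlinarith [norm_nonneg S]

/-- The admissible entries of each kind. -/
def patSet (n : ℕ) : Fin 3 → Finset ℕ := ![{0}, Finset.Ioo 0 n, {n}]

theorem filter_pattern {n : ℕ} (hn : 1 ≤ n) (P : Fin 4 → Fin 3) (hP : ∃ i, P i = 0) :
    (cube n).filter (fun m => pattern n m = P) = Fintype.piFinset fun i => patSet n (P i) := by
  ext m
  have key : ∀ i, m i ∈ patSet n (P i) ↔ m i ≤ n ∧ pattern n m i = P i := by
    intro i
    generalize P i = q
    unfold pattern patSet
    fin_cases q <;> simp <;> split_ifs <;> simp <;> omega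
  simp only [Finset.mem_filter, mem_cube, Fintype.mem_piFinset, key, funext_iff, forall_and,
    and_assoc]
  refine and_congr_right fun h => and_iff_right_of_imp fun h1 => ?_
  obtain ⟨i, hi⟩ := hP
  refine ⟨i, ?_⟩
  have := (h1 i).trans hi
  unfold pattern at this
  by_contra hne
  rw [if_neg hne] at this
  split_ifs at this <;> revert this <;> decide

theorem filter_pattern_empty {n : ℕ} (P : Fin 4 → Fin 3) (hP : ¬ ∃ i, P i = 0) :
    (cube n).filter (fun m => pattern n m = P) = ∅ := by
  rw [Finset.filter_eq_empty_iff]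
  rintro m hm rfl
  obtain ⟨i, hi⟩ := (mem_cube.mp hm).2
  exact hP ⟨i, by simp [pattern, hi]⟩

theorem norm_sum_patSet_le {n : ℕ} (hn : 1 ≤ n) {u : ℝ} (hu : |u| ≤ 2) (a : Fin 3) :
    ‖∑ l ∈ patSet n a, unitExp u ^ l‖ ≤ majorant n u := by
  fin_cases a
  · simpa [patSet] using one_le_majorant hn hu
  · simpa [patSet] using norm_geom_sum_le hn hu
  · simpa [patSet, norm_unitExp] using one_le_majorant hn hu

/-- The majorant of the three-dimensional kernel. -/
noncomputable def prodMajorant (n : ℕ) (u : Fin 4 → ℝ) : ℝ :=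
  ∑ i : Fin 4, ∏ a : Fin 3, majorant n (u (i.succAbove a))

theorem prodMajorant_nonneg (n : ℕ) (u : Fin 4 → ℝ) : 0 ≤ prodMajorant n u :=
  Finset.sum_nonneg fun _ _ => Finset.prod_nonneg fun _ _ => majorant_nonneg _ _

/-- A fixed pattern describes a product set, so the sum factors. Some entry is `0`; its factor is
`1`, and the other three give one summand of `prodMajorant`. -/
theorem norm_pattern_sum_le {n : ℕ} (hn : 1 ≤ n) {u : Fin 4 → ℝ} (hu : ∀ i, |u i| ≤ 2)
    (P : Fin 4 → Fin 3) :
    ‖∑ m ∈ (cube n).filter (fun m => pattern n m = P), ∏ i, unitExp (u i) ^ m i‖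
      ≤ prodMajorant n u := by
  by_cases hP : ∃ i, P i = 0
  · rw [filter_pattern hn P hP, ← Finset.prod_univ_sum (fun i => patSet n (P i))
      (fun i l => unitExp (u i) ^ l), norm_prod]
    obtain ⟨i, hi⟩ := hP
    rw [Fin.prod_univ_succAbove _ i]
    have h1 : ‖∑ l ∈ patSet n (P i), unitExp (u i) ^ l‖ = 1 := by
      simp [hi, patSet]
    rw [h1, one_mul]
    calc _ ≤ ∏ a : Fin 3, majorant n (u (i.succAbove a)) :=
          Finset.prod_le_prod (fun _ _ => norm_nonneg _)
            fun a _ => norm_sum_patSet_le hn (hu _) _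
      _ ≤ _ := Finset.single_le_sum
          (f := fun i : Fin 4 => ∏ a : Fin 3, majorant n (u (i.succAbove a)))
          (fun _ _ => Finset.prod_nonneg fun _ _ => majorant_nonneg _ _) (Finset.mem_univ i)
  · rw [filter_pattern_empty P hP]
    simpa using prodMajorant_nonneg n u

theorem norm_kernel_le {n : ℕ} (hn : 1 ≤ n) {u : Fin 4 → ℝ} (hu : ∀ i, |u i| ≤ 2)
    (hu0 : ∑ i, u i = 0) {C : (Fin 4 → Fin 3) → ℂ} (hC : ∀ P, ‖C P‖ ≤ 24) :
    ‖∑ m ∈ cube n, C (pattern n m) * phi (latticeOf m) u‖ ≤ 1944 * prodMajorant n u := by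
  simp only [phi_latticeOf _ hu0]
  rw [← Finset.sum_fiberwise (cube n) (pattern n)]
  -- There are `3 ^ 4 = 81` patterns, and `1944 = 81 * 24`.
  calc _ ≤ ∑ P : Fin 4 → Fin 3, 24 * prodMajorant n u := by
        refine norm_sum_le_of_le _ fun P _ => ?_
        have : ∑ m ∈ (cube n).filter (fun m => pattern n m = P),
              C (pattern n m) * ∏ i, unitExp (u i) ^ m i
            = C P * ∑ m ∈ (cube n).filter (fun m => pattern n m = P),
              ∏ i, unitExp (u i) ^ m i := by
          rw [Finset.mul_sum]
          refine Finset.sum_congr rfl fun m hm => ?_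
          rw [(Finset.mem_filter.mp hm).2]
        rw [this, norm_mul]
        exact mul_le_mul (hC P) (norm_pattern_sum_le hn hu P) (norm_nonneg _) (by norm_num)
    _ = 1944 * prodMajorant n u := by
        rw [Finset.sum_const, Finset.card_univ]
        simp
        ring

theorem norm_alt_kernel_le {n : ℕ} (hn : 1 ≤ n) (χ : Equiv.Perm (Fin 4) →* ℤˣ)
    {t s : Fin 4 → ℝ} (ht : ∀ i, |t i| ≤ 1) (hs : ∀ i, |s i| ≤ 1) (ht0 : ∑ i, t i = 0)
    (hs0 : ∑ i, s i = 0) {C : (Fin 4 → Fin 3) → ℂ} (hC : ∀ P, ‖C P‖ ≤ 24) :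
    ‖∑ m ∈ cube n, C (pattern n m) *
        (alt χ (latticeOf m) t * starRingEnd ℂ (alt χ (latticeOf m) s))‖
      ≤ ∑ σ : Equiv.Perm (Fin 4), ∑ τ : Equiv.Perm (Fin 4),
        4 * prodMajorant n (fun i => t (σ i) - s (τ i)) := by
  have h : ∑ m ∈ cube n, C (pattern n m) *
        (alt χ (latticeOf m) t * starRingEnd ℂ (alt χ (latticeOf m) s))
      = ∑ σ : Equiv.Perm (Fin 4), ∑ τ : Equiv.Perm (Fin 4),
        (1 / 576) * (((χ σ : ℤ) : ℂ) * ((χ τ : ℤ) : ℂ)) *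
          ∑ m ∈ cube n, C (pattern n m) * phi (latticeOf m) (fun i => t (σ i) - s (τ i)) := by
    simp only [alt_mul_conj, Finset.mul_sum]
    rw [Finset.sum_comm]
    refine Finset.sum_congr rfl fun σ _ => ?_
    rw [Finset.sum_comm]
    refine Finset.sum_congr rfl fun τ _ => Finset.sum_congr rfl fun m _ => ?_
    ring
  rw [h]
  refine norm_sum_le_of_le _ fun σ _ => norm_sum_le_of_le _ fun τ _ => ?_
  have hu : ∀ i, |t (σ i) - s (τ i)| ≤ 2 := fun i =>
    (abs_sub _ _).trans (by linarith [ht (σ i), hs (τ i)])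
  have hu0 : ∑ i, (t (σ i) - s (τ i)) = 0 := by
    rw [Finset.sum_sub_distrib, Equiv.sum_comp σ t, Equiv.sum_comp τ s, ht0, hs0, sub_zero]
  have hk := norm_kernel_le hn hu hu0 hC
  have hp := prodMajorant_nonneg n fun i => t (σ i) - s (τ i)
  -- The constant `4` absorbs `1944 / 576`.
  rw [norm_mul, norm_mul, norm_mul, norm_unit_cast, norm_unit_cast]
  norm_num
  linarith

/-! ### Summation over the nodes -/

/-- On each side of `q` the distances `|q - a|` are distinct naturals below `R`, so each side is at
most a harmonic number. -/
theorem sum_one_div_one_add_abs_sub_le (S : Finset ℤ) (q : ℤ) (R : ℕ)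
    (h : ∀ a ∈ S, |q - a| < R) :
    ∑ a ∈ S, 1 / (1 + |(q : ℝ) - a|) ≤ 2 * (1 + Real.log R) := by
  have hH : ∑ i ∈ Finset.range R, 1 / (1 + (i : ℝ)) ≤ 1 + Real.log R := by
    refine le_trans (le_of_eq ?_) (harmonic_le_one_add_log R)
    simp only [harmonic, Rat.cast_sum]
    refine Finset.sum_congr rfl fun i _ => ?_
    push_cast
    rw [one_div, add_comm]
  have half : ∀ T ⊆ S, Set.InjOn (fun a => (q - a).natAbs) (T : Set ℤ) →
      ∑ a ∈ T, 1 / (1 + |(q : ℝ) - a|) ≤ 1 + Real.log R := by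
    intro T hT hinj
    refine le_trans ?_ hH
    have e : ∀ a ∈ T, 1 / (1 + |(q : ℝ) - a|) = 1 / (1 + ((q - a).natAbs : ℝ)) := by
      intro a _
      rw [Nat.cast_natAbs]
      push_cast
      rfl
    rw [Finset.sum_congr rfl e, ← Finset.sum_image (f := fun i : ℕ => 1 / (1 + (i : ℝ))) hinj]
    refine Finset.sum_le_sum_of_subset_of_nonneg ?_ fun i _ _ => by positivity
    intro i hi
    obtain ⟨a, ha, rfl⟩ := Finset.mem_image.mp hi
    have := abs_lt.mp (h a (hT ha))
    rw [Finset.mem_range]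
    omega
  rw [← Finset.sum_filter_add_sum_filter_not S (fun a => a ≤ q)]
  have h1 := half (S.filter fun a => a ≤ q) (Finset.filter_subset _ _) (by
    intro a ha b hb hab
    simp only [Finset.coe_filter, Set.mem_ofPred_eq] at ha hb hab
    omega)
  have h2 := half (S.filter fun a => ¬ a ≤ q) (Finset.filter_subset _ _) (by
    intro a ha b hb hab
    simp only [Finset.coe_filter, Set.mem_ofPred_eq] at ha hb hab
    omega)
  linarith

theorem one_add_log_le {n : ℕ} (hn : 2 ≤ n) :
    1 + Real.log ((20 * n + 1 : ℕ) : ℝ) ≤ 8 * Real.log n := by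
  have hn' : (2 : ℝ) ≤ n := by exact_mod_cast hn
  have h1 : Real.log 2 ≤ Real.log n := Real.log_le_log (by norm_num) hn'
  have h2 : Real.log ((20 * n + 1 : ℕ) : ℝ) ≤ Real.log ((n : ℝ) ^ 6) := by
    refine Real.log_le_log (by positivity) ?_
    push_cast
    have : (2 : ℝ) ^ 5 ≤ (n : ℝ) ^ 5 := by gcongr
    nlinarith
  rw [Real.log_pow] at h2
  push_cast at h2 ⊢
  linarith [Real.log_two_gt_d9]

theorem sum_majorant_le {n : ℕ} (hn : 2 ≤ n) {y : ℝ} (hy : |y| ≤ 1) :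
    ∑ a ∈ Finset.Icc (-(4 * n : ℤ)) (4 * n), majorant n (y - a / (4 * n))
      ≤ 1600 * (n * Real.log n) := by
  have hn' : (2 : ℝ) ≤ n := by exact_mod_cast hn
  have hn0 : (n : ℝ) ≠ 0 := by positivity
  unfold majorant
  rw [Finset.sum_comm]
  have key : ∀ p ∈ Finset.Icc (-2 : ℤ) 2, ∑ a ∈ Finset.Icc (-(4 * n : ℤ)) (4 * n),
      (5 * n / (1 + n * |y - a / (4 * n) - p|) : ℝ) ≤ 320 * (n * Real.log n) := by
    intro p hp
    rw [Finset.mem_Icc] at hp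
    have hp1 : (-2 : ℝ) ≤ p := by exact_mod_cast hp.1
    have hp2 : (p : ℝ) ≤ 2 := by exact_mod_cast hp.2
    obtain ⟨hy1, hy2⟩ := abs_le.mp hy
    -- Rescaling by `4n` turns the nodes into integers. Replacing `Y` by its floor changes each
    -- distance by at most `1`, which costs a constant factor.
    set Y : ℝ := 4 * n * (y - p) with hY
    set q := ⌊Y⌋ with hq
    have hq1 : (q : ℝ) ≤ Y := Int.floor_le Y
    have hq2 : Y < q + 1 := Int.lt_floor_add_one Y
    have hYu : Y ≤ 12 * n := by rw [hY]; nlinarith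
    have hYl : -(12 * n) ≤ Y := by rw [hY]; nlinarith
    have hqu : q ≤ 12 * n := by
      have : (q : ℝ) ≤ 12 * n := hq1.trans hYu
      exact_mod_cast this
    have hql : -(12 * n : ℤ) < q + 1 := by
      have : -(12 * n : ℝ) < q + 1 := hYl.trans_lt hq2
      exact_mod_cast this
    -- Here `|q| ≤ 12n` and `|a| ≤ 4n`, so `|q - a| ≤ 16n`.
    have hb := sum_one_div_one_add_abs_sub_le (Finset.Icc (-(4 * n : ℤ)) (4 * n)) q
      (20 * n + 1) (by
      intro a ha
      rw [Finset.mem_Icc] at ha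
      rw [abs_lt]
      push_cast
      omega)
    have hterm : ∀ a ∈ Finset.Icc (-(4 * n : ℤ)) (4 * n),
        (5 * n / (1 + n * |y - a / (4 * n) - p|) : ℝ) ≤ 20 * n * (1 / (1 + |(q : ℝ) - a|)) := by
      intro a _
      have e : n * |y - a / (4 * n) - p| = |Y - a| / 4 := by
        have e1 : Y - a = 4 * n * (y - a / (4 * n) - p) := by
          rw [hY]
          field_simp
          ring
        rw [e1, abs_mul, abs_of_nonneg (by positivity : (0 : ℝ) ≤ 4 * n)]
        ring
      have e2 : |(q : ℝ) - a| ≤ |Y - a| + 1 := by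
        have := abs_sub_abs_le_abs_sub ((q : ℝ) - a) (Y - a)
        have h3 : |((q : ℝ) - a) - (Y - a)| ≤ 1 := by
          rw [abs_le]
          constructor <;> linarith
        linarith
      rw [e, mul_one_div, div_le_div_iff₀ (by positivity) (by positivity)]
      nlinarith
    refine (Finset.sum_le_sum hterm).trans ?_
    rw [← Finset.mul_sum]
    have hl := one_add_log_le hn
    nlinarith
  refine (Finset.sum_le_sum key).trans ?_
  rw [Finset.sum_const]
  simp
  linarith

/-- Since the coordinates of `j` sum to zero, any three of them determine `j`. By positivity the sum
can be enlarged to a full box of triples, where it factors. -/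
theorem sum_prodMajorant_le {n : ℕ} (hn : 2 ≤ n) {t : Fin 4 → ℝ} (ht : ∀ i, |t i| ≤ 1)
    (σ τ : Equiv.Perm (Fin 4)) :
    ∑ j ∈ Lam n, prodMajorant n (fun i => t (σ i) - node n j (τ i))
      ≤ 4 * (1600 * (n * Real.log n)) ^ 3 := by
  unfold prodMajorant
  rw [Finset.sum_comm]
  have key : ∀ i : Fin 4, ∑ j ∈ Lam n, ∏ a : Fin 3,
      majorant n (t (σ (i.succAbove a)) - node n j (τ (i.succAbove a)))
        ≤ (1600 * (n * Real.log n)) ^ 3 := by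
    intro i
    set e : (Fin 4 → ℤ) → (Fin 3 → ℤ) := fun j a => j (τ (i.succAbove a)) with he
    set G : (Fin 3 → ℤ) → ℝ := fun v => ∏ a : Fin 3,
      majorant n (t (σ (i.succAbove a)) - v a / (4 * n)) with hG
    have hG0 : ∀ v, 0 ≤ G v := fun v => Finset.prod_nonneg fun _ _ => majorant_nonneg _ _
    have hinj : Set.InjOn e (Lam n : Set (Fin 4 → ℤ)) := by
      intro j hj k hk hjk
      have sum0 : ∀ j ∈ Lam n, ∑ l, j (τ l) = 0 := by
        intro j hj
        rw [Equiv.sum_comp τ j, Fin.sum_univ_four]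
        exact (mem_Lam.mp hj).1.1
      have h1 := sum0 j hj
      have h2 := sum0 k hk
      rw [Fin.sum_univ_succAbove _ i] at h1 h2
      have h3 : ∀ a, j (τ (i.succAbove a)) = k (τ (i.succAbove a)) := fun a => congrFun hjk a
      simp only [h3] at h1
      have h4 : ∀ l, j (τ l) = k (τ l) := by
        intro l
        rcases Fin.eq_self_or_eq_succAbove i l with rfl | ⟨a, rfl⟩
        · omega
        · exact h3 a
      funext l
      simpa using h4 (τ.symm l)
    classical
    have hsub : (Lam n).image e ⊆ Fintype.piFinset fun _ : Fin 3 =>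
        Finset.Icc (-(4 * n : ℤ)) (4 * n) := by
      intro v hv
      obtain ⟨j, hj, rfl⟩ := Finset.mem_image.mp hv
      rw [Lam] at hj
      have hbox := (Finset.mem_filter.mp hj).1
      rw [box, Fintype.mem_piFinset] at hbox
      rw [Fintype.mem_piFinset]
      exact fun a => hbox _
    calc _ = ∑ v ∈ (Lam n).image e, G v := (Finset.sum_image hinj).symm
      _ ≤ ∑ v ∈ Fintype.piFinset fun _ : Fin 3 => Finset.Icc (-(4 * n : ℤ)) (4 * n), G v :=
          Finset.sum_le_sum_of_subset_of_nonneg hsub fun v _ _ => hG0 v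
      _ = ∏ a : Fin 3, ∑ x ∈ Finset.Icc (-(4 * n : ℤ)) (4 * n),
            majorant n (t (σ (i.succAbove a)) - x / (4 * n)) :=
          (Finset.prod_univ_sum (fun _ : Fin 3 => Finset.Icc (-(4 * n : ℤ)) (4 * n)) fun a x =>
            majorant n (t (σ (i.succAbove a)) - x / (4 * n))).symm
      _ ≤ ∏ _a : Fin 3, 1600 * (n * Real.log n) :=
          Finset.prod_le_prod (fun _ _ => Finset.sum_nonneg fun _ _ => majorant_nonneg _ _)
            fun a _ => sum_majorant_le hn (ht _)
      _ = _ := by simp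
  refine (Finset.sum_le_sum fun i _ => key i).trans (le_of_eq ?_)
  simp

theorem abs_le_one_of_mem_Tetra {t : Fin 4 → ℝ} (ht : t ∈ Tetra) (i : Fin 4) : |t i| ≤ 1 := by
  obtain ⟨h0, ⟨h1, h2⟩, ⟨h3, h4⟩, ⟨h5, h6⟩, h7, h8⟩ := ht
  rw [abs_le]
  fin_cases i <;> simp <;> constructor <;> linarith

theorem sum_eq_zero_of_mem_Tetra {t : Fin 4 → ℝ} (ht : t ∈ Tetra) : ∑ i, t i = 0 := by
  rw [Fin.sum_univ_four]
  exact ht.1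

theorem sum_norm_alt_kernel_le {n : ℕ} (hn : 2 ≤ n) (χ : Equiv.Perm (Fin 4) →* ℤˣ)
    {t : Fin 4 → ℝ} (ht : t ∈ Tetra) {C : (Fin 4 → Fin 3) → ℂ} (hC : ∀ P, ‖C P‖ ≤ 24) :
    ∑ j ∈ Lam n, ‖∑ m ∈ cube n, C (pattern n m) *
        (alt χ (latticeOf m) t * starRingEnd ℂ (alt χ (latticeOf m) (node n j)))‖
      ≤ 9216 * (1600 * (n * Real.log n)) ^ 3 := by
  calc _ ≤ ∑ j ∈ Lam n, ∑ σ : Equiv.Perm (Fin 4), ∑ τ : Equiv.Perm (Fin 4),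
        4 * prodMajorant n (fun i => t (σ i) - node n j (τ i)) :=
        Finset.sum_le_sum fun j hj => norm_alt_kernel_le (by omega) χ
          (abs_le_one_of_mem_Tetra ht) (abs_le_one_of_mem_Tetra (node_mem hj))
          (sum_eq_zero_of_mem_Tetra ht) (sum_eq_zero_of_mem_Tetra (node_mem hj)) hC
    _ = ∑ σ : Equiv.Perm (Fin 4), ∑ τ : Equiv.Perm (Fin 4),
        4 * ∑ j ∈ Lam n, prodMajorant n (fun i => t (σ i) - node n j (τ i)) := by
        rw [Finset.sum_comm]
        refine Finset.sum_congr rfl fun σ _ => ?_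
        rw [Finset.sum_comm]
        simp only [Finset.mul_sum]
    _ ≤ ∑ σ : Equiv.Perm (Fin 4), ∑ τ : Equiv.Perm (Fin 4),
        4 * (4 * (1600 * (n * Real.log n)) ^ 3) := by
        gcongr with σ _ τ _
        exact sum_prodMajorant_le hn (abs_le_one_of_mem_Tetra ht) σ τ
    _ = _ := by
        simp only [Finset.sum_const, Finset.card_univ, Fintype.card_perm, Fintype.card_fin]
        simp [Nat.factorial]
        ring

/-! ### Identification of the two kernels and conclusion -/

theorem sum_cube_alt {n : ℕ} (χ : Equiv.Perm (Fin 4) →* ℤˣ) (t s : Fin 4 → ℝ)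
    (C : (Fin 4 → Fin 3) → ℂ) (hC : ∀ P (σ : Equiv.Perm (Fin 4)), C (P ∘ σ) = C P)
    (w : (Fin 4 → ℤ) → ℂ) (hw : ∀ m ∈ chamber n,
      C (pattern n m) * (alt χ (latticeOf m) t * starRingEnd ℂ (alt χ (latticeOf m) s)) =
      w (latticeOf m) * stab m *
        (alt χ (latticeOf m) t * starRingEnd ℂ (alt χ (latticeOf m) s))) :
    ∑ m ∈ cube n, C (pattern n m) *
        (alt χ (latticeOf m) t * starRingEnd ℂ (alt χ (latticeOf m) s))
      = 24 * ∑ k ∈ Lam n, w k * (alt χ k t * starRingEnd ℂ (alt χ k s)) := by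
  rw [sum_cube_eq, sum_Lam]
  · congr 1
    refine Finset.sum_congr rfl fun m hm => ?_
    have : (stab m : ℂ) ≠ 0 := by exact_mod_cast (stab_pos m).ne'
    rw [hw m hm]
    field_simp
  · intro σ m
    rw [latticeOf_comp, alt_mul_conj_comp]
    congr 1
    exact hC (pattern n m) σ

theorem sum_Lam_weight {n : ℕ} (hn : 1 ≤ n) (t s : Fin 4 → ℝ) :
    ∑ m ∈ cube n, (patWeight (pattern n m) : ℂ) *
        (alt 1 (latticeOf m) t * starRingEnd ℂ (alt 1 (latticeOf m) s))
      = 24 * ∑ k ∈ Lam n, (weight n k : ℂ) * TC k t * starRingEnd ℂ (TC k s) := by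
  rw [sum_cube_alt 1 t s (fun P => (patWeight P : ℂ)) (fun P σ => by rw [patWeight_comp])
    (fun k => (weight n k : ℂ))]
  · simp only [TC_eq_alt, mul_assoc]
  · intro m hm
    simp only [← weight_latticeOf hn hm, Nat.cast_mul]

theorem patCount_pattern_two_eq_zero {n : ℕ} {m : Fin 4 → ℕ} (hm : m ∈ chamber n) :
    patCount (pattern n m) 2 = 0 ↔ m 0 = 0 ∨ m 0 < n := by
  rw [mem_chamber_iff] at hm
  rw [patCount, Finset.card_eq_zero, Finset.filter_eq_empty_iff]
  simp only [pattern]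
  constructor
  · intro hh
    have := hh (Finset.mem_univ 0)
    by_contra hlt
    refine this ?_
    rw [if_neg (by omega), if_pos (by omega)]
  · intro hlt i _
    have : m i ≤ m 0 := by fin_cases i <;> simp <;> omega
    split_ifs
    · decide
    · omega
    · decide

/-- The generalized sines vanish at indices with two equal entries, so only strictly decreasing `m`
matter. The remaining condition `m 0 < n` says that the pattern contains no entry `n`. -/
theorem sum_LamInt_eq {n : ℕ} (t s : Fin 4 → ℝ) :
    ∑ m ∈ cube n, (if patCount (pattern n m) 2 = 0 then (1 : ℂ) else 0) *
        (alt Equiv.Perm.sign (latticeOf m) t *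
          starRingEnd ℂ (alt Equiv.Perm.sign (latticeOf m) s))
      = 24 * ∑ k ∈ LamInt n, TS k t * starRingEnd ℂ (TS k s) := by
  classical
  rw [sum_cube_alt Equiv.Perm.sign t s (fun P => if patCount P 2 = 0 then (1 : ℂ) else 0)
    (fun P σ => by rw [patCount_comp]) (fun k => if k ∈ LamInt n then 1 else 0)]
  · simp only [TS_eq_alt, map_neg, neg_mul_neg, ite_mul, one_mul, zero_mul]
    rw [← Finset.sum_filter, Finset.filter_mem_eq_inter,
      Finset.inter_eq_right.mpr (LamInt_subset n)]
  · intro m hm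
    simp only [latticeOf_mem_LamInt hm]
    rw [mem_chamber_iff] at hm
    by_cases h : m 0 = m 1 ∨ m 1 = m 2 ∨ m 2 = m 3
    · have hz : alt Equiv.Perm.sign (latticeOf m) t = 0 := by
        rcases h with h | h | h
        · exact alt_sign_eq_zero (i := 0) (j := 1) (by decide) (by simp [latticeOf, h]) t
        · exact alt_sign_eq_zero (i := 1) (j := 2) (by decide) (by simp [latticeOf, h]) t
        · exact alt_sign_eq_zero (i := 2) (j := 3) (by decide) (by simp [latticeOf, h]) t
      rw [hz, zero_mul, mul_zero, mul_zero]
    · have hst : stab m = 1 := by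
        rw [stab_eq_of_antitone ![0, 1, 2, 3] (by omega) (by decide) (by simp; omega)
          (by simp; omega) (by simp; omega)]
        decide
      have hp := patCount_pattern_two_eq_zero (mem_chamber_iff.mpr hm)
      rw [hst]
      simp only [hp]
      congr 1
      rw [Nat.cast_one, mul_one]
      refine if_congr ?_ rfl rfl
      omega

theorem weight_le (n : ℕ) (j : Fin 4 → ℤ) : weight n j ≤ 24 := by
  unfold weight
  split_ifs <;> norm_num

theorem sum_norm_ellInt_le {n : ℕ} (hn : 2 ≤ n) {t : Fin 4 → ℝ} (ht : t ∈ Tetra) :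
    ∑ j ∈ LamInt n, ‖ellInt n j t‖ ≤ 6 * 9216 * 1600 ^ 3 * Real.log n ^ 3 := by
  have hn0 : (0 : ℝ) < n := by positivity
  have h := sum_norm_alt_kernel_le hn Equiv.Perm.sign ht
    (C := fun P => if patCount P 2 = 0 then (1 : ℂ) else 0)
    (fun P => by split_ifs <;> norm_num)
  simp only [sum_LamInt_eq] at h
  refine (Finset.sum_le_sum_of_subset_of_nonneg (LamInt_subset n)
    fun _ _ _ => norm_nonneg _).trans ?_
  -- The normalization is `144 = 6 * 24`, the `24` being the factor from unfolding.
  have e : ∀ j, ‖ellInt n j t‖ = 6 / (n : ℝ) ^ 3 *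
      ‖24 * ∑ k ∈ LamInt n, TS k t * starRingEnd ℂ (TS k (node n j))‖ := by
    intro j
    unfold ellInt
    rw [norm_mul, norm_mul, norm_div, norm_pow, Complex.norm_natCast]
    norm_num
    ring
  simp only [e]
  rw [← Finset.mul_sum]
  refine (mul_le_mul_of_nonneg_left h (by positivity)).trans (le_of_eq ?_)
  field_simp

theorem sum_norm_ellStar_le {n : ℕ} (hn : 2 ≤ n) {t : Fin 4 → ℝ} (ht : t ∈ Tetra) :
    ∑ j ∈ Lam n, ‖ellStar n j t‖ ≤ 6 * 9216 * 1600 ^ 3 * Real.log n ^ 3 := by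
  have hn0 : (0 : ℝ) < n := by positivity
  have h := sum_norm_alt_kernel_le hn 1 ht (C := fun P => (patWeight P : ℂ))
    (fun P => by rw [Complex.norm_natCast]; exact_mod_cast patWeight_le P)
  simp only [sum_Lam_weight (by omega : 1 ≤ n)] at h
  -- Already `weight n j / 4 ≤ 6`; the extra `24` is given away so that both operators share one
  -- constant.
  have e : ∀ j, ‖ellStar n j t‖ ≤ 6 / (n : ℝ) ^ 3 *
      ‖24 * ∑ k ∈ Lam n, (weight n k : ℂ) * TC k t * starRingEnd ℂ (TC k (node n j))‖ := by
    intro j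
    unfold ellStar
    have hw : (weight n j : ℝ) ≤ 24 := by exact_mod_cast weight_le n j
    rw [norm_mul, norm_mul, norm_div, norm_mul, norm_pow, Complex.norm_natCast,
      Complex.norm_natCast, ← mul_assoc]
    refine mul_le_mul_of_nonneg_right ?_ (norm_nonneg _)
    norm_num
    rw [div_mul_eq_mul_div, div_le_div_iff₀ (by positivity) (by positivity)]
    nlinarith [pow_pos hn0 3]
  refine (Finset.sum_le_sum fun j _ => e j).trans ?_
  rw [← Finset.mul_sum]
  refine (mul_le_mul_of_nonneg_left h (by positivity)).trans (le_of_eq ?_)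
  field_simp

end TetraInterp

theorem mainTheorem1 :
    ∃ c : ℝ, ∀ n : ℕ, 2 ≤ n →
      ‖TetraInterp.interpInt n‖ ≤ c * Real.log n ^ 3 ∧
      ‖TetraInterp.interpStar n‖ ≤ c * Real.log n ^ 3 := by
  refine ⟨6 * 9216 * 1600 ^ 3, fun n hn => ?_⟩
  have hlog : 0 ≤ Real.log n := Real.log_natCast_nonneg n
  have hc : 0 ≤ 6 * 9216 * 1600 ^ 3 * Real.log n ^ 3 := by positivity
  constructor
  · refine ContinuousLinearMap.opNorm_le_bound _ hc fun f => ?_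
    refine (ContinuousMap.norm_le _ (mul_nonneg hc (norm_nonneg f))).mpr fun t => ?_
    rw [TetraInterp.interpInt_apply]
    refine le_trans ?_ (mul_le_mul_of_nonneg_right (TetraInterp.sum_norm_ellInt_le hn t.2)
      (norm_nonneg f))
    rw [← Finset.sum_coe_sort (TetraInterp.LamInt n), Finset.sum_mul]
    refine norm_sum_le_of_le _ fun j _ => ?_
    rw [norm_mul, mul_comm]
    exact mul_le_mul_of_nonneg_left (f.norm_coe_le_norm _) (norm_nonneg _)
  · refine ContinuousLinearMap.opNorm_le_bound _ hc fun f => ?_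
    refine (ContinuousMap.norm_le _ (mul_nonneg hc (norm_nonneg f))).mpr fun t => ?_
    rw [TetraInterp.interpStar_apply]
    refine le_trans ?_ (mul_le_mul_of_nonneg_right (TetraInterp.sum_norm_ellStar_le hn t.2)
      (norm_nonneg f))
    rw [← Finset.sum_coe_sort (TetraInterp.Lam n), Finset.sum_mul]
    refine norm_sum_le_of_le _ fun j _ => ?_
    rw [norm_mul, mul_comm]
    exact mul_le_mul_of_nonneg_left (f.norm_coe_le_norm _) (norm_nonneg _)
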